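/- Let $\mathbb{T}$ be the unit circle with normalized Lebesgue measure. For $p\in\{2,\infty\}$ let $H^p$ be the Hardy space, regarded through boundary values as the subspace of $L^p(\mathbb{T})$ of functions whose Fourier coefficients of negative index vanish; for $h\in H^\infty$, $h(0)$ denotes the value at $0$ of its holomorphic extension to the unit disk. For $\psi\in L^\infty(\mathbb{T})$ let $T_\psi:H^2\to H^2$ be the Toeplitz operator $T_\psi f=P_+(\psi f)$, where $P_+:L^2(\mathbb{T})\to H^2$ is the orthogonal projection. For $b\in H^\infty$ with $\|b\|_{H^\infty}\le 1$, the de Branges–Rovnyak space $\mathcal{H}(b)$ is the range of $A=(I-T_bT_{\overline b})^{1/2}$ on $H^2$, with the norm given by $\|Ag\|_{\mathcal{H}(b)}=\|g\|_{H^2}$ for $g\in H^2\ominus\ker A$. Theorem. Let $(h_n)$ be a sequence in $H^\infty$ such that $\|h_n\|_{H^\infty}\le 1$ for all $n$ and $\lim_{n\to\infty}h_n(0)=1$. Then, for every $b\in H^\infty$ with $\|b\|_{H^\infty}\le 1$ and every $f\in\mathcal{H}(b)$, we have $T_{\overline{h_n}}f\in\mathcal{H}(b)$ for all $n$, and $$\lim_{n\to\infty}\|T_{\overline{h_n}}f-f\|_{\mathcal{H}(b)}=0.$$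 -/

import Mathlib

open MeasureTheory Filter Topology
open scoped ENNReal

noncomputable section

namespace DBR

instance factTwoPiPos : Fact (0 < 2 * Real.pi) := ⟨Real.two_pi_pos⟩

/-- The unit circle, parametrized by the angle `θ` modulo `2π`; the monomial `fourier n` is
`θ ↦ exp (i n θ)`. -/
abbrev Torus : Type := AddCircle (2 * Real.pi)

/-- Normalized Lebesgue measure `dθ / 2π` on the circle. -/
abbrev torusMeasure : Measure Torus := AddCircle.haarAddCircle

/-- The space `L²` of the circle. -/
abbrev L2 : Type := Lp ℂ 2 torusMeasure

/-- The space `L^∞` of the circle, with the essential supremum norm. -/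
abbrev LInf : Type := Lp ℂ ∞ torusMeasure

theorem integrable_of_Lp {p : ℝ≥0∞} (hp : 1 ≤ p) (f : Lp ℂ p torusMeasure) :
    Integrable (f : Torus → ℂ) torusMeasure :=
  (Lp.memLp f).integrable hp

/-- For `1 ≤ p ≤ ∞`, the Hardy space `H^p`, identified through radial boundary values with the
subspace of those functions in `L^p` of the circle whose Fourier coefficients of negative index
all vanish. -/
def hardy (p : ℝ≥0∞) [hp : Fact (1 ≤ p)] : Submodule ℂ (Lp ℂ p torusMeasure) where
  carrier := {f | ∀ n : ℤ, n < 0 → fourierCoeff (f : Torus → ℂ) n = 0}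
  zero_mem' := by
    intro n _
    rw [fourierCoeff_congr_ae (Lp.coeFn_zero ℂ p torusMeasure)]
    simp [fourierCoeff]
  add_mem' := by
    intro f g hf hg n hn
    rw [fourierCoeff_congr_ae (Lp.coeFn_add f g),
      fourierCoeff.add (integrable_of_Lp hp.out f) (integrable_of_Lp hp.out g)]
    simp [hf n hn, hg n hn]
  smul_mem' := by
    intro c f hf n hn
    rw [fourierCoeff_congr_ae (Lp.coeFn_smul c f), fourierCoeff.const_smul]
    simp [hf n hn]

/-- The Hardy space `H²`, as a subspace of `L²` of the circle. -/
abbrev H2 : Submodule ℂ L2 := hardy 2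

/-- The space `H^∞`, as a subspace of `L^∞` of the circle. -/
abbrev HInf : Submodule ℂ LInf := hardy ∞

theorem isClosed_H2 : IsClosed (H2 : Set L2) := by
  have h : (H2 : Set L2) = ⋂ (n : ℤ) (_ : n < 0), {f : L2 | fourierBasis.repr f n = 0} := by
    ext f
    simp only [Set.mem_iInter, Set.mem_ofPred_eq, fourierBasis_repr]
    rfl
  rw [h]
  refine isClosed_iInter fun n => isClosed_iInter fun _ => ?_
  simp_rw [HilbertBasis.repr_apply_apply]
  exact isClosed_eq (by fun_prop) continuous_const

instance completeSpace_H2 : CompleteSpace H2 := isClosed_H2.completeSpace_coe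

/-- The value `h z` at a point `z` of the open unit disk of the holomorphic function with boundary
function `h`, computed from its Taylor series at the origin. -/
def evalDisk (h : HInf) (z : ℂ) : ℂ :=
  ∑' n : ℕ, fourierCoeff ((h : LInf) : Torus → ℂ) (n : ℤ) * z ^ n

/-- Multiplication by a function `ψ ∈ L^∞`, as a bounded operator on `L²`. -/
def mulOp (ψ : LInf) : L2 →L[ℂ] L2 :=
  (ContinuousLinearMap.mul ℂ ℂ).holderL torusMeasure ∞ 2 2 ψ

/-- The Toeplitz operator `T_ψ f = P₊ (ψ f)` on `H²`, where `P₊` is the orthogonal projection of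
`L²` onto `H²`. -/
def toeplitz (ψ : LInf) : H2 →L[ℂ] H2 :=
  H2.orthogonalProjectionOnto ∘L mulOp ψ ∘L H2.subtypeL

section RangeSpace

variable {H : Type*} [NormedAddCommGroup H] [InnerProductSpace ℂ H] [CompleteSpace H]

/-- The positive square root `A^{1/2}` of a bounded positive operator `A` on a Hilbert space. -/
def sqrtOp (A : H →L[ℂ] H) : H →L[ℂ] H := CFC.sqrt A

/-- The range of a bounded operator `A`; a separate type, because it carries
the norm for which `A` is a partial isometry onto it, not the norm of `H`. -/
def RangeSpace (A : H →L[ℂ] H) : Type _ := LinearMap.range (A : H →ₗ[ℂ] H)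

namespace RangeSpace

instance addCommGroup (A : H →L[ℂ] H) : AddCommGroup (RangeSpace A) :=
  inferInstanceAs (AddCommGroup (LinearMap.range (A : H →ₗ[ℂ] H)))

instance module (A : H →L[ℂ] H) : Module ℂ (RangeSpace A) :=
  inferInstanceAs (Module ℂ (LinearMap.range (A : H →ₗ[ℂ] H)))

/-- An element of the range space, as a vector of `H`. -/
def val {A : H →L[ℂ] H} (f : RangeSpace A) : H :=
  Subtype.val (p := fun x => x ∈ LinearMap.range (A : H →ₗ[ℂ] H)) f

/-- A vector in the range of `A`, as an element of the range space. -/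
def mk {A : H →L[ℂ] H} (f : H) (hf : f ∈ LinearMap.range (A : H →ₗ[ℂ] H)) : RangeSpace A :=
  ⟨f, hf⟩

/-- `A`, restricted to the orthogonal complement of its kernel, as a map onto its range. -/
def coimageMap (A : H →L[ℂ] H) :
    (LinearMap.ker (A : H →ₗ[ℂ] H))ᗮ →ₗ[ℂ] RangeSpace A :=
  (A : H →ₗ[ℂ] H).rangeRestrict.domRestrict (LinearMap.ker (A : H →ₗ[ℂ] H))ᗮ

theorem bijective_coimageMap (A : H →L[ℂ] H) : Function.Bijective (coimageMap A) := by
  have hc : IsClosed ((LinearMap.ker (A : H →ₗ[ℂ] H) : Submodule ℂ H) : Set H) :=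
    A.isClosed_ker
  have : CompleteSpace (LinearMap.ker (A : H →ₗ[ℂ] H)) := hc.completeSpace_coe
  constructor
  · rw [← LinearMap.ker_eq_bot, LinearMap.ker_eq_bot']
    intro g hg
    have hA : A (g : H) = 0 := congrArg val hg
    have hker : (g : H) ∈ LinearMap.ker (A : H →ₗ[ℂ] H) := hA
    exact Subtype.ext (inner_self_eq_zero.mp (g.2 _ hker))
  · rintro ⟨_, x, rfl⟩
    obtain ⟨y, hy, z, hz, rfl⟩ :=
      (LinearMap.ker (A : H →ₗ[ℂ] H)).exists_add_mem_mem_orthogonal x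
    refine ⟨⟨z, hz⟩, Subtype.ext ?_⟩
    have hy0 : A y = 0 := hy
    change A z = A (y + z)
    rw [map_add, hy0, zero_add]

/-- The linear bijection `(ker A)ᗮ ≃ range A` given by `A`. -/
def coimageEquiv (A : H →L[ℂ] H) :
    (LinearMap.ker (A : H →ₗ[ℂ] H))ᗮ ≃ₗ[ℂ] RangeSpace A :=
  LinearEquiv.ofBijective (coimageMap A) (bijective_coimageMap A)

/-- The range norm: `‖A g‖ = ‖g‖` for `g` orthogonal to the kernel of `A`. -/
instance normedAddCommGroup (A : H →L[ℂ] H) : NormedAddCommGroup (RangeSpace A) :=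
  NormedAddCommGroup.induced (RangeSpace A) (LinearMap.ker (A : H →ₗ[ℂ] H))ᗮ
    (coimageEquiv A).symm (coimageEquiv A).symm.injective

theorem norm_coimageMap (A : H →L[ℂ] H) (g : (LinearMap.ker (A : H →ₗ[ℂ] H))ᗮ) :
    ‖coimageMap A g‖ = ‖(g : H)‖ := by
  change ‖(coimageEquiv A).symm (coimageEquiv A g)‖ = ‖g‖
  rw [LinearEquiv.symm_apply_apply]

end RangeSpace

end RangeSpace

/-- The operator `(I - T_b T_b̄)^{1/2}` on `H²`. -/
def defectOp (b : HInf) : H2 →L[ℂ] H2 :=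
  sqrtOp (1 - toeplitz (b : LInf) * toeplitz (star (b : LInf)))

/-- The de Branges–Rovnyak space `H(b)`: the range of `(I - T_b T_b̄)^{1/2}`, with the norm that
makes this operator a partial isometry of `H²` onto `H(b)`. -/
abbrev DeBrangesRovnyak (b : HInf) : Type := RangeSpace (defectOp b)

/-- `H(b)` as a linear subspace of `H²`. -/
def deBrangesRovnyakSubmodule (b : HInf) : Submodule ℂ H2 :=
  LinearMap.range (defectOp b : H2 →ₗ[ℂ] H2)

end DBR

end

open scoped InnerProductSpace InnerProduct

/-! Let `A = (I - T_b T_b̄)^{1/2}`. Two facts about `T_{h_n}` suffice: `‖A T_{h_n} g‖ ≤ ‖A g‖`, and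
`T_{h_n} → I` strongly. By duality the first makes `T_{h̄_n}`, the adjoint, a contraction for the
range norm: if `f = A y`, then `T_{h̄_n} f = A z_n` with `z_n ⟂ ker A` and `‖z_n‖ ≤ ‖y‖`. The second
gives `⟪z_n, A g⟫ = ⟪A y, T_{h_n} g⟫ → ⟪y, A g⟫`, so `z_n → y` weakly, the range of `A` being dense
in `(ker A)ᗮ`. The norm bound upgrades this to norm convergence. The inequality
(`norm_defectOp_toeplitz_le`) comes from `‖A g‖² = (‖g‖² - ‖b̄ g‖²) + ‖P₋(b̄ g)‖²`: replacing `g` by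
`h g` decreases the first term pointwise and the second because `P₋ h = P₋ h P₋`. Strong convergence
(`tendsto_mulOp`) is checked on exponentials, where `⟪e_k, h_n e_k⟫ = h_n(0) → 1`. -/

namespace DBR

/-! ### Abstract Hilbert space: contractions of a range norm. -/

section Hilbert

variable {H : Type*} [NormedAddCommGroup H] [InnerProductSpace ℂ H]

/-- A sequence of vectors of norm at most `‖y‖` whose inner products with `y` tend to `‖y‖ ^ 2`
converges to `y`. -/
theorem tendsto_of_norm_le_of_tendsto_inner {x : ℕ → H} {y : H} (hx : ∀ n, ‖x n‖ ≤ ‖y‖)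
    (hi : Tendsto (fun n => ⟪y, x n⟫_ℂ) atTop (𝓝 ⟪y, y⟫_ℂ)) : Tendsto x atTop (𝓝 y) := by
  have hre : Tendsto (fun n => (⟪y, x n⟫_ℂ).re) atTop (𝓝 (‖y‖ ^ 2)) := by
    have h := (Complex.continuous_re.tendsto _).comp hi
    have e : (⟪y, y⟫_ℂ).re = ‖y‖ ^ 2 := inner_self_eq_norm_sq (𝕜 := ℂ) y
    rwa [e] at h
  have hsq : Tendsto (fun n => ‖x n - y‖ ^ 2) atTop (𝓝 0) := by
    have hup : Tendsto (fun n => 2 * ‖y‖ ^ 2 - 2 * (⟪y, x n⟫_ℂ).re) atTop (𝓝 0) := by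
      have := (hre.const_mul 2).const_sub (2 * ‖y‖ ^ 2)
      rwa [sub_self] at this
    refine squeeze_zero (fun n => by positivity) (fun n => ?_) hup
    have h1 : ‖x n - y‖ ^ 2 = ‖x n‖ ^ 2 - 2 * (⟪x n, y⟫_ℂ).re + ‖y‖ ^ 2 :=
      norm_sub_sq (𝕜 := ℂ) (x n) y
    have h2 : (⟪x n, y⟫_ℂ).re = (⟪y, x n⟫_ℂ).re := inner_re_symm (𝕜 := ℂ) _ _
    have h3 : ‖x n‖ ^ 2 ≤ ‖y‖ ^ 2 := by gcongr; exact hx n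
    linarith
  rw [tendsto_iff_norm_sub_tendsto_zero]
  have h := hsq.sqrt
  simpa [Real.sqrt_sq] using h

/-- The vectors on which a uniformly bounded sequence of operators tends to zero form a closed
subspace. -/
theorem tendsto_zero_of_mem_closure_span {E F : Type*} [NormedAddCommGroup E] [NormedSpace ℂ E]
    [NormedAddCommGroup F] [NormedSpace ℂ F] {T : ℕ → E →L[ℂ] F} {C : ℝ} (hT : ∀ n, ‖T n‖ ≤ C)
    {s : Set E} (hs : ∀ x ∈ s, Tendsto (fun n => T n x) atTop (𝓝 0)) {x : E}
    (hx : x ∈ closure (Submodule.span ℂ s : Set E)) : Tendsto (fun n => T n x) atTop (𝓝 0) := by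
  have hC : 0 ≤ C := (norm_nonneg _).trans (hT 0)
  have hspan : ∀ y ∈ Submodule.span ℂ s, Tendsto (fun n => T n y) atTop (𝓝 0) := by
    intro y hy
    induction hy using Submodule.span_induction with
    | mem y hy => exact hs y hy
    | zero => simp
    | add y z _ _ hy hz => simpa using hy.add hz
    | smul c y _ hy => simpa using hy.const_smul c
  rw [Metric.tendsto_atTop]
  intro ε hε
  -- `C + 1` rather than `C`, since `C` may be zero.
  obtain ⟨y, hy, hxy⟩ := Metric.mem_closure_iff.mp hx (ε / (2 * (C + 1))) (by positivity)
  obtain ⟨N, hN⟩ := Metric.tendsto_atTop.mp (hspan y hy) (ε / 2) (by positivity)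
  refine ⟨N, fun n hn => ?_⟩
  have h1 := hN n hn
  rw [dist_zero_right] at h1 ⊢
  rw [dist_eq_norm, lt_div_iff₀ (by positivity)] at hxy
  have h2 : ‖T n (x - y)‖ ≤ C * ‖x - y‖ := (T n).le_of_opNorm_le (hT n) _
  have h3 : ‖T n x‖ ≤ ‖T n (x - y)‖ + ‖T n y‖ := by
    simpa using norm_add_le (T n (x - y)) (T n y)
  nlinarith [norm_nonneg (x - y)]

variable [CompleteSpace H]

theorem isSelfAdjoint_sqrtOp (A : H →L[ℂ] H) : IsSelfAdjoint (sqrtOp A) :=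
  IsSelfAdjoint.of_nonneg (CFC.sqrt_nonneg A)

theorem norm_sqrtOp_apply_sq {A : H →L[ℂ] H} (hA : 0 ≤ A) (g : H) :
    ((‖sqrtOp A g‖ ^ 2 : ℝ) : ℂ) = ⟪A g, g⟫_ℂ := by
  have hsq : sqrtOp A * sqrtOp A = A := CFC.sqrt_mul_sqrt_self A hA
  have hsymm : ∀ u v, ⟪sqrtOp A u, v⟫_ℂ = ⟪u, sqrtOp A v⟫_ℂ := (isSelfAdjoint_sqrtOp A).isSymmetric
  conv_rhs => rw [← hsq, mul_apply_eq_comp, hsymm, inner_self_eq_norm_sq_to_K]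
  push_cast
  rfl

/-- If `‖A S g‖ ≤ ‖A g‖` for all `g`, with `A` self-adjoint, then the adjoint of `S` acts as a
contraction on the range of `A`, for the range norm. -/
theorem exists_mem_orthogonal_ker_apply_eq {A S : H →L[ℂ] H} (hA : IsSelfAdjoint A)
    (hAS : ∀ g, ‖A (S g)‖ ≤ ‖A g‖) (y : H) :
    ∃ z ∈ (LinearMap.ker (A : H →ₗ[ℂ] H))ᗮ, A z = (S†) (A y) ∧ ‖z‖ ≤ ‖y‖ := by
  have hsymm : ∀ u v, ⟪A u, v⟫_ℂ = ⟪u, A v⟫_ℂ := hA.isSymmetric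
  let K : Submodule ℂ H := LinearMap.ker (A : H →ₗ[ℂ] H)
  let ψ : H →ₗ[ℂ] ℂ := (innerSL ℂ y ∘L A ∘L S : H →L[ℂ] ℂ)
  have hψ : K ≤ LinearMap.ker ψ := by
    intro g hg
    have hg0 : A g = 0 := hg
    have h := hAS g
    rw [hg0, norm_zero, norm_le_zero_iff] at h
    simp [ψ, h]
  -- The functional `A g ↦ ⟪y, A (S g)⟫`; it is well defined because `hAS` forces `A ∘ S` to vanish
  -- on `ker A`.
  let φ : LinearMap.range (A : H →ₗ[ℂ] H) →ₗ[ℂ] ℂ :=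
    K.liftQ ψ hψ ∘ₗ (A : H →ₗ[ℂ] H).quotKerEquivRange.symm.toLinearMap
  have hφ : ∀ (g : H) (hg : A g ∈ LinearMap.range (A : H →ₗ[ℂ] H)),
      φ ⟨A g, hg⟩ = ⟪y, A (S g)⟫_ℂ := by
    intro g hg
    have h := (A : H →ₗ[ℂ] H).quotKerEquivRange_symm_apply_image g hg
    change K.liftQ ψ hψ ((A : H →ₗ[ℂ] H).quotKerEquivRange.symm ⟨(A : H →ₗ[ℂ] H) g, hg⟩) = _
    rw [h]
    rfl
  let Φ : StrongDual ℂ (LinearMap.range (A : H →ₗ[ℂ] H)) := φ.mkContinuous ‖y‖ (by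
    rintro ⟨_, g, rfl⟩
    have hg : A g ∈ LinearMap.range (A : H →ₗ[ℂ] H) := ⟨g, rfl⟩
    change ‖φ ⟨A g, hg⟩‖ ≤ ‖y‖ * ‖A g‖
    rw [hφ]
    exact (norm_inner_le_norm _ _).trans (by gcongr; exact hAS g))
  -- Hahn–Banach, then Riesz: the representing vector `w` satisfies `⟪w, A g⟫ = ⟪y, A (S g)⟫`, that
  -- is, `A w = S† A y`.
  obtain ⟨Ψ, hΨ, hΨn⟩ := exists_extension_norm_eq _ Φ
  let w : H := (InnerProductSpace.toDual ℂ H).symm Ψ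
  have hw : ‖w‖ ≤ ‖y‖ := by
    rw [LinearIsometryEquiv.norm_map, hΨn]
    exact φ.mkContinuous_norm_le (norm_nonneg y) _
  have hKc : CompleteSpace K := A.isClosed_ker.completeSpace_coe
  have hAw : A w = (S†) (A y) := by
    refine ext_inner_right ℂ fun g => ?_
    rw [hsymm, ContinuousLinearMap.adjoint_inner_left, hsymm]
    change ⟪(InnerProductSpace.toDual ℂ H).symm Ψ, A g⟫_ℂ = _
    rw [InnerProductSpace.toDual_symm_apply]
    have h := hΨ ⟨A g, ⟨g, rfl⟩⟩
    rw [← hφ g ⟨g, rfl⟩]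
    exact h
  -- Discarding the component of `w` in `ker A` keeps `A w` and does not increase the norm.
  refine ⟨Kᗮ.starProjection w, Kᗮ.starProjection_apply_mem w, ?_, ?_⟩
  · have h0 : A (K.starProjection w) = 0 := K.starProjection_apply_mem w
    have h1 : A (w - K.starProjection w) = A w := by rw [map_sub, h0, sub_zero]
    rw [← hAw, ← h1, Submodule.starProjection_orthogonal_val]
  · exact (Kᗮ.norm_starProjection_apply_le w).trans hw

/-- A sequence of operators which contract the range norm of the self-adjoint operator `A` and
whose adjoints converge strongly to the identity converges strongly on the range of `A`. -/
theorem exists_tendsto_of_norm_apply_le {A : H →L[ℂ] H} (hA : IsSelfAdjoint A) {S : ℕ → H →L[ℂ] H}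
    (hAS : ∀ n g, ‖A (S n g)‖ ≤ ‖A g‖) (hS : ∀ g, Tendsto (fun n => S n g) atTop (𝓝 g))
    (y : (LinearMap.ker (A : H →ₗ[ℂ] H))ᗮ) :
    ∃ z : ℕ → (LinearMap.ker (A : H →ₗ[ℂ] H))ᗮ,
      (∀ n, A (z n) = ((S n)†) (A y)) ∧ Tendsto z atTop (𝓝 y) := by
  have hsymm : ∀ u v, ⟪A u, v⟫_ℂ = ⟪u, A v⟫_ℂ := hA.isSymmetric
  choose z hz hAz hzn using fun n => exists_mem_orthogonal_ker_apply_eq hA (hAS n) (y : H)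
  refine ⟨fun n => ⟨z n, hz n⟩, hAz, ?_⟩
  rw [tendsto_subtype_rng]
  refine tendsto_of_norm_le_of_tendsto_inner hzn ?_
  have hyc : (y : H) ∈ closure (Submodule.span ℂ (Set.range A) : Set H) := by
    have hker : (LinearMap.ker (A : H →ₗ[ℂ] H))ᗮ =
        (LinearMap.range (A : H →ₗ[ℂ] H)).topologicalClosure := by
      rw [A.orthogonal_ker, hA.adjoint_eq]
    have h : (y : H) ∈ (LinearMap.range (A : H →ₗ[ℂ] H)).topologicalClosure := hker ▸ y.2
    exact closure_mono (fun _ hx => Submodule.subset_span hx) h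
  -- The varying vector `z n - y` sits in the conjugate-linear slot, so that it defines linear
  -- functionals, uniformly bounded and tested on the range of `A`.
  have hlim : Tendsto (fun n => innerSL ℂ (z n - y) (y : H)) atTop (𝓝 0) := by
    refine tendsto_zero_of_mem_closure_span (C := 2 * ‖(y : H)‖) (fun n => ?_) ?_ hyc
    · rw [innerSL_apply_norm]
      linarith [norm_sub_le (z n) (y : H), hzn n]
    · rintro _ ⟨g, rfl⟩
      have hg : ∀ n, innerSL ℂ (z n - y) (A g) = ⟪A y, S n g - g⟫_ℂ := by
        intro n
        rw [innerSL_apply_apply, inner_sub_left, ← hsymm, ← hsymm, hAz,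
          ContinuousLinearMap.adjoint_inner_left, inner_sub_right]
      simp_rw [hg]
      have h : Tendsto (fun n => ⟪A y, S n g - g⟫_ℂ) atTop (𝓝 ⟪A y, g - g⟫_ℂ) :=
        tendsto_const_nhds.inner ((hS g).sub_const g)
      simpa using h
  have h3 : Tendsto (fun n => (starRingEnd ℂ) ⟪z n - y, (y : H)⟫_ℂ + ⟪(y : H), (y : H)⟫_ℂ) atTop
      (𝓝 ((starRingEnd ℂ) 0 + ⟪(y : H), (y : H)⟫_ℂ)) :=
    ((Complex.continuous_conj.tendsto _).comp hlim).add_const _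
  simpa [inner_conj_symm, inner_sub_right] using h3

end Hilbert

/-! ### Multiplication operators on `L²`. -/

theorem coeFn_mulOp (ψ : LInf) (g : L2) :
    (mulOp ψ g : Torus → ℂ) =ᵐ[torusMeasure] fun x => ψ x * g x :=
  (ContinuousLinearMap.mul ℂ ℂ).coeFn_holder (r := 2) ψ g

theorem ae_norm_le_of_norm_le_one {ψ : LInf} (hψ : ‖ψ‖ ≤ 1) : ∀ᵐ x ∂torusMeasure, ‖ψ x‖ ≤ 1 := by
  have h : eLpNorm ψ ∞ torusMeasure ≤ 1 := by
    rw [← ENNReal.toReal_le_toReal (Lp.eLpNorm_ne_top ψ) (by simp)]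
    simpa [Lp.norm_def] using hψ
  rw [eLpNorm_exponent_top] at h
  filter_upwards [ae_le_eLpNormEssSup (f := ψ) (μ := torusMeasure)] with x hx
  have h1 : ‖ψ x‖ₑ ≤ ‖(1 : ℂ)‖ₑ := by simpa using hx.trans h
  simpa using enorm_le_iff_norm_le.mp h1

theorem norm_sq_eq_integral (g : L2) : ‖g‖ ^ 2 = ∫ x, ‖g x‖ ^ 2 ∂torusMeasure := by
  have h := L2.inner_def (𝕜 := ℂ) g g
  rw [inner_self_eq_norm_sq_to_K] at h
  have h2 : ∀ x, ⟪g x, g x⟫_ℂ = ((‖g x‖ ^ 2 : ℝ) : ℂ) := fun x => by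
    rw [inner_self_eq_norm_sq_to_K]; norm_cast
  simp_rw [h2, integral_complex_ofReal] at h
  exact Complex.ofReal_injective (by push_cast; exact h)

theorem integrable_norm_sq (g : L2) : Integrable (fun x => ‖g x‖ ^ 2) torusMeasure :=
  (Lp.memLp g).integrable_norm_pow (by simp)

theorem inner_mulOp_left (ψ : LInf) (f g : L2) :
    ⟪mulOp ψ f, g⟫_ℂ = ⟪f, mulOp (star ψ) g⟫_ℂ := by
  rw [L2.inner_def, L2.inner_def]
  refine integral_congr_ae ?_
  filter_upwards [coeFn_mulOp ψ f, coeFn_mulOp (star ψ) g, Lp.coeFn_star ψ] with x h1 h2 h3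
  rw [h1, h2, h3]
  simp [mul_comm, mul_left_comm]

theorem mulOp_comm (φ ψ : LInf) (g : L2) : mulOp φ (mulOp ψ g) = mulOp ψ (mulOp φ g) := by
  refine Lp.ext ?_
  filter_upwards [coeFn_mulOp φ (mulOp ψ g), coeFn_mulOp ψ (mulOp φ g), coeFn_mulOp φ g,
    coeFn_mulOp ψ g] with x h1 h2 h3 h4
  rw [h1, h2, h3, h4]
  ring

theorem norm_mulOp_apply_le {ψ : LInf} (hψ : ‖ψ‖ ≤ 1) (g : L2) : ‖mulOp ψ g‖ ≤ ‖g‖ := by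
  refine Lp.norm_le_norm_of_ae_le ?_
  filter_upwards [coeFn_mulOp ψ g, ae_norm_le_of_norm_le_one hψ] with x h1 h2
  rw [h1, norm_mul]
  exact mul_le_of_le_one_left (norm_nonneg _) h2

theorem norm_star_LInf (ψ : LInf) : ‖star ψ‖ = ‖ψ‖ := by
  rw [Lp.norm_def, Lp.norm_def]
  exact congrArg _ AEEqFun.eLpNorm_star

/-- The integrated form of `0 ≤ (1 - |φ|²) (1 - |ψ|²) |g|²`. -/
theorem norm_mulOp_sub_le {φ ψ : LInf} (hφ : ‖φ‖ ≤ 1) (hψ : ‖ψ‖ ≤ 1) (g : L2) :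
    ‖mulOp φ g‖ ^ 2 - ‖mulOp ψ (mulOp φ g)‖ ^ 2 ≤ ‖g‖ ^ 2 - ‖mulOp ψ g‖ ^ 2 := by
  simp_rw [norm_sq_eq_integral]
  rw [← integral_sub (integrable_norm_sq _) (integrable_norm_sq _),
    ← integral_sub (integrable_norm_sq _) (integrable_norm_sq _)]
  refine integral_mono_ae ((integrable_norm_sq _).sub (integrable_norm_sq _))
    ((integrable_norm_sq _).sub (integrable_norm_sq _)) ?_
  filter_upwards [coeFn_mulOp φ g, coeFn_mulOp ψ (mulOp φ g), coeFn_mulOp ψ g,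
    ae_norm_le_of_norm_le_one hφ, ae_norm_le_of_norm_le_one hψ] with x h1 h2 h3 h4 h5
  rw [h2, h1, h3]
  simp only [norm_mul, mul_pow]
  have h6 : 0 ≤ 1 - ‖φ x‖ ^ 2 := by nlinarith [norm_nonneg (φ x)]
  have h7 : 0 ≤ 1 - ‖ψ x‖ ^ 2 := by nlinarith [norm_nonneg (ψ x)]
  nlinarith [mul_nonneg (mul_nonneg h6 h7) (sq_nonneg ‖g x‖)]

/-! ### Fourier coefficients and the invariance of `H²`. -/

theorem inner_fourierLp_mulOp (ψ : LInf) (m k : ℤ) :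
    ⟪(fourierLp 2 m : L2), mulOp ψ (fourierLp 2 k)⟫_ℂ = fourierCoeff (ψ : Torus → ℂ) (m - k) := by
  rw [L2.inner_def]
  refine integral_congr_ae ?_
  filter_upwards [coeFn_mulOp ψ (fourierLp 2 k), coeFn_fourierLp 2 m, coeFn_fourierLp 2 k]
    with x h1 h2 h3
  rw [h1, h2, h3, neg_sub, sub_eq_add_neg, fourier_add, fourier_neg, RCLike.inner_apply, smul_eq_mul]
  ring

theorem mem_H2_iff {g : L2} : g ∈ H2 ↔ ∀ n : ℤ, n < 0 → ⟪(fourierLp 2 n : L2), g⟫_ℂ = 0 := by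
  have h : ∀ n, ⟪(fourierLp 2 n : L2), g⟫_ℂ = fourierCoeff (g : Torus → ℂ) n := fun n => by
    rw [← fourierBasis_repr, HilbertBasis.repr_apply_apply, coe_fourierBasis]
  simp_rw [h]
  rfl

theorem mulOp_mem_H2 (h : HInf) {g : L2} (hg : g ∈ H2) : mulOp h g ∈ H2 := by
  rw [mem_H2_iff] at hg ⊢
  intro m hm
  have hstar : ⟪(fourierLp 2 m : L2), mulOp h g⟫_ℂ =
      ⟪mulOp (star (h : LInf)) (fourierLp 2 m), g⟫_ℂ := by
    rw [inner_mulOp_left, star_star]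
  rw [hstar, ← (fourierBasis (T := 2 * Real.pi)).tsum_inner_mul_inner]
  refine (tsum_congr fun k => ?_).trans tsum_zero
  rw [coe_fourierBasis, inner_mulOp_left, star_star, inner_fourierLp_mulOp]
  -- Each Parseval term is `ĥ(m - k) ĝ(k)` with `m < 0`: either `k < 0`, or `m - k < 0`.
  rcases lt_or_ge k 0 with hk | hk
  · rw [hg k hk, mul_zero]
  · rw [h.2 (m - k) (by omega), zero_mul]

/-! ### Toeplitz operators and the defect form. -/

theorem coe_toeplitz (h : HInf) (g : H2) : (toeplitz (h : LInf) g : L2) = mulOp h g :=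
  H2.starProjection_eq_self_iff.mpr (mulOp_mem_H2 h g.2)

theorem adjoint_toeplitz (ψ : LInf) : (toeplitz ψ)† = toeplitz (star ψ) := by
  refine ((ContinuousLinearMap.eq_adjoint_iff _ _).mpr fun f g => ?_).symm
  change ⟪H2.orthogonalProjectionOnto (mulOp (star ψ) f), g⟫_ℂ =
    ⟪f, H2.orthogonalProjectionOnto (mulOp ψ g)⟫_ℂ
  rw [Submodule.inner_orthogonalProjectionOnto_eq_of_mem_right,
    Submodule.inner_orthogonalProjectionOnto_eq_of_mem_left, inner_mulOp_left, star_star]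

theorem norm_toeplitz_apply_le {ψ : LInf} (hψ : ‖ψ‖ ≤ 1) (g : H2) : ‖toeplitz ψ g‖ ≤ ‖g‖ :=
  (H2.norm_orthogonalProjectionOnto_apply_le _).trans (norm_mulOp_apply_le hψ _)

theorem isSelfAdjoint_defectOp (b : HInf) : IsSelfAdjoint (defectOp b) :=
  isSelfAdjoint_sqrtOp _

/-- `T_b` is the adjoint of the contraction `T_b̄`, so `I - T_b T_b̄` is positive and its square
root has this quadratic form. -/
theorem norm_defectOp_apply_sq {b : HInf} (hb : ‖b‖ ≤ 1) (g : H2) :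
    ‖defectOp b g‖ ^ 2 = ‖g‖ ^ 2 - ‖toeplitz (star (b : LInf)) g‖ ^ 2 := by
  have hb' : ‖star (b : LInf)‖ ≤ 1 := (norm_star_LInf _).trans_le hb
  set B := toeplitz (star (b : LInf)) with hB
  have hadj : toeplitz (b : LInf) = B† := by rw [hB, adjoint_toeplitz, star_star]
  have hinner : ∀ u : H2, ⟪(1 - toeplitz (b : LInf) * B) u, u⟫_ℂ =
      ((‖u‖ ^ 2 - ‖B u‖ ^ 2 : ℝ) : ℂ) := by
    intro u
    rw [sub_apply, inner_sub_left, hadj, mul_apply_eq_comp,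
      ContinuousLinearMap.adjoint_inner_left, one_apply_eq_self,
      inner_self_eq_norm_sq_to_K, inner_self_eq_norm_sq_to_K]
    push_cast
    rfl
  have hpos : 0 ≤ 1 - toeplitz (b : LInf) * B := by
    rw [ContinuousLinearMap.nonneg_iff_isPositive, ContinuousLinearMap.isPositive_iff_complex]
    intro u
    rw [hinner]
    have := norm_toeplitz_apply_le hb' u
    refine ⟨by rw [RCLike.re_to_complex, Complex.ofReal_re], ?_⟩
    rw [RCLike.re_to_complex, Complex.ofReal_re, sub_nonneg]
    gcongr
  exact Complex.ofReal_injective ((norm_sqrtOp_apply_sq hpos g).trans (hinner g))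

theorem norm_toeplitz_apply_sq (ψ : LInf) (g : H2) :
    ‖toeplitz ψ g‖ ^ 2 =
      ‖mulOp ψ g‖ ^ 2 - ‖H2ᗮ.orthogonalProjectionOnto (mulOp ψ g)‖ ^ 2 := by
  rw [H2.norm_sq_eq_add_norm_sq_projection (mulOp ψ g), add_sub_cancel_right]
  rfl

/-- Since `H²` is invariant under multiplication by `h ∈ H^∞`, the projection onto its orthogonal
complement satisfies `P₋ h = P₋ h P₋`. -/
theorem norm_orthogonalProjectionOnto_mulOp_le {h : HInf} (hh : ‖h‖ ≤ 1) (u : L2) :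
    ‖H2ᗮ.orthogonalProjectionOnto (mulOp h u)‖ ≤ ‖H2ᗮ.orthogonalProjectionOnto u‖ := by
  have h1 : mulOp h u = mulOp h (H2.orthogonalProjectionOnto u) +
      mulOp h (H2ᗮ.orthogonalProjectionOnto u) := by
    rw [← map_add]
    exact congrArg _ (H2.starProjection_add_starProjection_orthogonal u).symm
  have h2 : H2ᗮ.orthogonalProjectionOnto (mulOp h (H2.orthogonalProjectionOnto u : L2)) = 0 :=
    Submodule.orthogonalProjectionOnto_orthogonal_apply_eq_zero (mulOp_mem_H2 h (Subtype.mem _))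
  rw [h1, map_add, h2, zero_add]
  exact (H2ᗮ.norm_orthogonalProjectionOnto_apply_le _).trans (norm_mulOp_apply_le hh _)

/-- Multiplication by a function in the unit ball of `H^∞` contracts the quadratic form of
`I - T_b T_b̄`. -/
theorem norm_defectOp_toeplitz_le {b h : HInf} (hb : ‖b‖ ≤ 1) (hh : ‖h‖ ≤ 1) (g : H2) :
    ‖defectOp b (toeplitz (h : LInf) g)‖ ≤ ‖defectOp b g‖ := by
  have hb' : ‖star (b : LInf)‖ ≤ 1 := (norm_star_LInf _).trans_le hb
  have hQ := norm_orthogonalProjectionOnto_mulOp_le hh (mulOp (star (b : LInf)) g)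
  -- Commuting `h` past `b̄` turns the bound into `‖P₋(b̄ h g)‖ ≤ ‖P₋(b̄ g)‖`.
  rw [mulOp_comm, ← sq_le_sq₀ (norm_nonneg _) (norm_nonneg _)] at hQ
  have hh' : ‖(h : LInf)‖ ≤ 1 := hh
  have hM := norm_mulOp_sub_le hh' hb' (g : L2)
  have hT : ‖toeplitz (h : LInf) g‖ = ‖mulOp (h : LInf) (g : L2)‖ := by
    rw [← coe_toeplitz]
    rfl
  have hg : ‖g‖ = ‖(g : L2)‖ := rfl
  rw [← sq_le_sq₀ (norm_nonneg _) (norm_nonneg _), norm_defectOp_apply_sq hb,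
    norm_defectOp_apply_sq hb, norm_toeplitz_apply_sq (star (b : LInf)),
    norm_toeplitz_apply_sq (star (b : LInf)), hT, hg, coe_toeplitz]
  linarith only [hQ, hM]

/-! ### Strong convergence to the identity. -/

theorem evalDisk_zero (h : HInf) : evalDisk h 0 = fourierCoeff ((h : LInf) : Torus → ℂ) 0 := by
  rw [evalDisk, tsum_eq_single 0 fun n hn => by simp [hn]]
  simp

/-- Multiplication by `h_n` converges strongly to the identity of `L²`. -/
theorem tendsto_mulOp {h : ℕ → HInf} (hnorm : ∀ n, ‖h n‖ ≤ 1)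
    (hzero : Tendsto (fun n => evalDisk (h n) 0) atTop (𝓝 1)) (g : L2) :
    Tendsto (fun n => mulOp (h n) g) atTop (𝓝 g) := by
  have hg : g ∈ closure (Submodule.span ℂ (Set.range (fourierLp 2 : ℤ → L2)) : Set L2) := by
    have := span_fourierLp_closure_eq_top (T := 2 * Real.pi) (p := 2) (by simp)
    rw [← Submodule.topologicalClosure_coe, this]
    trivial
  have key : Tendsto (fun n => (mulOp (h n) - 1 : L2 →L[ℂ] L2) g) atTop (𝓝 0) := by
    refine tendsto_zero_of_mem_closure_span (C := 2) (fun n => ?_) ?_ hg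
    · refine ContinuousLinearMap.opNorm_le_bound _ (by norm_num) fun u => ?_
      have h1 : ‖mulOp (h n : LInf) u‖ ≤ ‖u‖ := norm_mulOp_apply_le (hnorm n) u
      have h2 := norm_sub_le (mulOp (h n) u) u
      change ‖mulOp (h n) u - u‖ ≤ _
      linarith
    · rintro _ ⟨k, rfl⟩
      have hk : Tendsto (fun n => mulOp (h n) (fourierLp 2 k)) atTop (𝓝 (fourierLp 2 k : L2)) := by
        -- The inner product with `e_k` is the zeroth Fourier coefficient of `h n`, whatever `k` is.
        refine tendsto_of_norm_le_of_tendsto_inner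
          (fun n => norm_mulOp_apply_le (hnorm n) _) ?_
        have hone : ⟪(fourierLp 2 k : L2), fourierLp 2 k⟫_ℂ = 1 := by
          rw [inner_self_eq_norm_sq_to_K, orthonormal_fourier.1 k]
          simp
        simp_rw [inner_fourierLp_mulOp, sub_self, ← evalDisk_zero, hone]
        exact hzero
      simpa using hk.sub_const (fourierLp 2 k : L2)
  simpa using key.add_const g

theorem tendsto_toeplitz {h : ℕ → HInf} (hnorm : ∀ n, ‖h n‖ ≤ 1)
    (hzero : Tendsto (fun n => evalDisk (h n) 0) atTop (𝓝 1)) (g : H2) :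
    Tendsto (fun n => toeplitz (h n : LInf) g) atTop (𝓝 g) := by
  rw [tendsto_subtype_rng]
  simp_rw [coe_toeplitz]
  exact tendsto_mulOp hnorm hzero g

end DBR

/-! ### Convergence in `H(b)`. -/

theorem theoremT (h : ℕ → DBR.HInf) (hnorm : ∀ n, ‖h n‖ ≤ 1)
    (hzero : Filter.Tendsto (fun n => DBR.evalDisk (h n) 0) Filter.atTop (nhds 1))
    (b : DBR.HInf) (hb : ‖b‖ ≤ 1) (f : DBR.DeBrangesRovnyak b) :
    ∃ hmem : ∀ n, DBR.toeplitz (star (h n : DBR.LInf)) f.val ∈ DBR.deBrangesRovnyakSubmodule b,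
      Filter.Tendsto
        (fun n => ‖(DBR.RangeSpace.mk (DBR.toeplitz (star (h n : DBR.LInf)) f.val) (hmem n) :
          DBR.DeBrangesRovnyak b) - f‖)
        Filter.atTop (nhds 0) := by
  obtain ⟨y, rfl⟩ := (DBR.RangeSpace.bijective_coimageMap (DBR.defectOp b)).2 f
  obtain ⟨z, hz, hlim⟩ := DBR.exists_tendsto_of_norm_apply_le (DBR.isSelfAdjoint_defectOp b)
    (fun n => DBR.norm_defectOp_toeplitz_le hb (hnorm n)) (DBR.tendsto_toeplitz hnorm hzero) y
  have hz' : ∀ n, DBR.defectOp b (z n) = DBR.toeplitz (star (h n : DBR.LInf))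
      (DBR.RangeSpace.coimageMap (DBR.defectOp b) y).val := fun n => by
    rw [hz n, DBR.adjoint_toeplitz]
    rfl
  refine ⟨fun n => ⟨z n, hz' n⟩, ?_⟩
  -- The difference is the image of `z n - y`, which lies in `(ker A)ᗮ`, so its range norm is `‖z n
  -- - y‖`.
  have hdiff : ∀ n, (DBR.RangeSpace.mk (DBR.toeplitz (star (h n : DBR.LInf))
        (DBR.RangeSpace.coimageMap (DBR.defectOp b) y).val) ⟨z n, hz' n⟩ :
          DBR.DeBrangesRovnyak b) - DBR.RangeSpace.coimageMap (DBR.defectOp b) y =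
      DBR.RangeSpace.coimageMap (DBR.defectOp b) (z n - y) := fun n => by
    rw [map_sub]
    congr 1
    exact Subtype.ext (hz' n).symm
  simp_rw [hdiff, DBR.RangeSpace.norm_coimageMap]
  have hnorm0 : Tendsto (fun n => ‖z n - y‖) atTop (𝓝 0) :=
    tendsto_iff_norm_sub_tendsto_zero.mp hlim
  exact hnorm0
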